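/- Let $\mathcal G$ be a locally compact, not necessarily Hausdorff, étale groupoid: a groupoid with a locally compact topology such that the groupoid operations are continuous, the unit space $\mathcal G^{(0)}\subset\mathcal G$ is locally compact Hausdorff in the relative topology, and the range and source maps $r,s\colon\mathcal G\to\mathcal G^{(0)}$ are local homeomorphisms. Write $\mathcal G_x=s^{-1}(x)$, $\mathcal G^x=r^{-1}(x)$, and $\mathcal G^x_x=\mathcal G_x\cap\mathcal G^x$ for the isotropy group at $x\in\mathcal G^{(0)}$. An open bisection is an open set $U\subset\mathcal G$ on which $r$ and $s$ are injective. Let $C_c(\mathcal G)$ be the linear span, in the space of all functions $\mathcal G\to\mathbb C$, of the continuous compactly supported functions on open Hausdorff subsets $V\subset\mathcal G$, extended by zero to $\mathcal G$. With the convolution product and the involution $f^*(g)=\overline{f(g^{-1})}$ it is a $*$-algebra. For $x\in\mathcal G^{(0)}$ it is represented on $\ell^2(\mathcal G_x)$ by $$(\rho_x(f)\xi)(g)=\sum_{h\in\mathcal G^{r(g)}}f(h)\,\xi(h^{-1}g).$$ Let $C^*_r(\mathcal G)$ be the completion of $C_c(\mathcal G)$ in the norm $\|f\|_r=\sup_{x\in\mathcal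 G^{(0)}}\|\rho_x(f)\|$; each $\rho_x$ extends to a representation of $C^*_r(\mathcal G)$. A representation $\pi$ of a C$^*$-algebra is weakly contained in a representation $\sigma$ if $\ker\sigma\subset\ker\pi$. **Proposition.** Let $Y\subset\mathcal G^{(0)}$ be $\mathcal G$-invariant (for $g\in\mathcal G$, $s(g)\in Y$ if and only if $r(g)\in Y$), and let $x\in\mathcal G^{(0)}\setminus Y$. Suppose that, for some $n\ge1$, there are elements $g_1,\dots,g_n\in\mathcal G^x_x\setminus\{x\}$, open bisections $U_1,\dots,U_n$ with $g_k\in U_k$, and a neighbourhood $U$ of $x$ in $\mathcal G^{(0)}$ such that $Y\cap U\subset U_1\cup\dots\cup U_n$, and that $$\sum_{k=1}^n\frac1{\operatorname{ord}(g_k)}<1,$$ where $\operatorname{ord}(g_k)\in\{2,3,\dots,+\infty\}$ is the order of $g_k$ in the group $\mathcal G^x_x$ and $1/\infty=0$. Then the representation $\rho_x$ of $C^*_r(\mathcal G)$ is not weakly contained in $\bigoplus_{y\in Y}\rho_y$. -/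

import Mathlib

open scoped ENNReal NNReal Topology
open Set

noncomputable section

/-- A (small) groupoid given by its set `G` of arrows.  The unit space is identified with the set
of arrows `g` such that `src g = g`; `src g` and `rng g` are the source and the range of `g`,
viewed as units.  Products `g * h` are meaningful only for composable pairs, that is, when
`src g = rng h`; no axiom concerns the other values of `*`, and they are never used. -/
class ArrowGroupoid (G : Type*) extends Mul G, Inv G where
  src : G → G
  rng : G → G
  src_src : ∀ g, src (src g) = src g
  rng_src : ∀ g, rng (src g) = src g
  src_rng : ∀ g, src (rng g) = rng g
  rng_rng : ∀ g, rng (rng g) = rng g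
  src_mul : ∀ g h, src g = rng h → src (g * h) = src h
  rng_mul : ∀ g h, src g = rng h → rng (g * h) = rng g
  mul_assoc' : ∀ g h k, src g = rng h → src h = rng k → g * h * k = g * (h * k)
  mul_src : ∀ g, g * src g = g
  rng_mul_self : ∀ g, rng g * g = g
  src_inv : ∀ g, src g⁻¹ = rng g
  rng_inv : ∀ g, rng g⁻¹ = src g
  inv_mul_self : ∀ g, g⁻¹ * g = src g
  mul_inv_self : ∀ g, g * g⁻¹ = rng g

namespace ArrowGroupoid

variable (G : Type*) [ArrowGroupoid G]

/-- The unit space `G⁽⁰⁾ ⊆ G`. -/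
abbrev UnitSpace : Type _ := {x : G // src x = x}

variable {G}

/-- The source map as a map into the unit space. -/
def srcMap (g : G) : UnitSpace G := ⟨src g, src_src g⟩

/-- The range map as a map into the unit space. -/
def rngMap (g : G) : UnitSpace G := ⟨rng g, src_rng g⟩

/-- The fibre `G_x = s⁻¹(x)`. -/
abbrev SrcFiber (x : UnitSpace G) : Type _ := {g : G // src g = (x : G)}

/-- The fibre `G^u = r⁻¹(u)`. -/
abbrev RngFiber (u : G) : Type _ := {h : G // rng h = u}

/-- The arrow `h⁻¹ g ∈ G_x` for `g ∈ G_x` and `h ∈ G^{r(g)}`. -/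
def invMul {x : UnitSpace G} (g : SrcFiber x) (h : RngFiber (rng (g : G))) : SrcFiber x :=
  ⟨(h : G)⁻¹ * g, by rw [src_mul _ _ (by rw [src_inv, h.2]), g.2]⟩

/-- A subset `Y` of the unit space is invariant if an arrow has its source in `Y` if and only if
it has its range in `Y`. -/
def IsInvariant (Y : Set (UnitSpace G)) : Prop :=
  ∀ g : G, srcMap g ∈ Y ↔ rngMap g ∈ Y

lemma rng_unit (x : UnitSpace G) : rng (x : G) = x := by
  have h := rng_src (x : G)
  rwa [x.2] at h

/-- The isotropy group `G_x^x = G_x ∩ G^x`. -/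
def Isotropy (x : UnitSpace G) : Type _ := {g : G // src g = (x : G) ∧ rng g = (x : G)}

/-- The isotropy group `G_x^x` with the operations of `G`; its identity is the unit `x`. -/
instance (x : UnitSpace G) : Group (Isotropy x) where
  mul g h := ⟨g.1 * h.1, by
    have e : src g.1 = rng h.1 := by rw [g.2.1, h.2.2]
    exact ⟨by rw [src_mul _ _ e, h.2.1], by rw [rng_mul _ _ e, g.2.2]⟩⟩
  one := ⟨x.1, x.2, rng_unit x⟩
  inv g := ⟨g.1⁻¹, by rw [src_inv, g.2.2], by rw [rng_inv, g.2.1]⟩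
  mul_assoc g h k := Subtype.ext <|
    mul_assoc' g.1 h.1 k.1 (by rw [g.2.1, h.2.2]) (by rw [h.2.1, k.2.2])
  one_mul g := Subtype.ext <| by
    have := rng_mul_self g.1
    rw [g.2.2] at this
    exact this
  mul_one g := Subtype.ext <| by
    have := mul_src g.1
    rw [g.2.1] at this
    exact this
  inv_mul_cancel g := Subtype.ext <| by
    have := inv_mul_self g.1
    rw [g.2.1] at this
    exact this

end ArrowGroupoid

open ArrowGroupoid

/-- A locally compact, not necessarily Hausdorff, étale groupoid. -/
class EtaleGroupoid (G : Type*) [TopologicalSpace G] extends ArrowGroupoid G where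
  locallyCompact : LocallyCompactSpace G
  continuousOn_mul : ContinuousOn (fun p : G × G => p.1 * p.2) {p | src p.1 = rng p.2}
  continuous_inv : Continuous (fun g : G => g⁻¹)
  locallyCompact_units : LocallyCompactSpace (UnitSpace G)
  t2_units : T2Space (UnitSpace G)
  isLocalHomeomorph_src : IsLocalHomeomorph (srcMap : G → UnitSpace G)
  isLocalHomeomorph_rng : IsLocalHomeomorph (rngMap : G → UnitSpace G)

/-- An open bisection: an open set of arrows on which source and range are injective (hence, for an
étale groupoid, homeomorphisms onto open subsets of the unit space). -/
def IsOpenBisection {G : Type*} [TopologicalSpace G] [EtaleGroupoid G] (U : Set G) : Prop :=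
  IsOpen U ∧ InjOn src U ∧ InjOn rng U

/-- The space `C_c(G)`: the linear span, in the space of all functions on `G`, of the functions
that vanish outside some open Hausdorff set `V` and whose restriction to `V` is continuous with
compact support. -/
def Cc (G : Type*) [TopologicalSpace G] : Submodule ℂ (G → ℂ) :=
  Submodule.span ℂ {f | ∃ V : Set G, IsOpen V ∧ T2Space V ∧ ContinuousOn f V ∧
    ∃ K ⊆ V, IsCompact K ∧ ∀ g ∉ K, f g = 0}

/-- The Hilbert space `ℓ²(I)`. -/
abbrev Ell2 (I : Type*) : Type _ := lp (fun _ : I => ℂ) 2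

/-! ### Boundedness of the regular representations -/

namespace RegBound

/-- `‖f‖_{ℓ¹}` is uniformly bounded on the fibres of `φ`. -/
def FiberBdd {G X : Type*} (φ : G → X) (f : G → ℂ) (C : ℝ≥0) : Prop :=
  ∀ u : X, ∑' h : {h : G // φ h = u}, ‖f h‖ₑ ≤ C

lemma exists_fiberBdd {G X : Type*} [TopologicalSpace G] {φ : G → X}
    (hφ : ∀ g : G, ∃ W : Set G, IsOpen W ∧ g ∈ W ∧ InjOn φ W) {f : G → ℂ} (hf : f ∈ Cc G) :
    ∃ C, FiberBdd φ f C := by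
  induction hf using Submodule.span_induction with
  | mem f hf =>
    obtain ⟨V, -, -, hc, K, hKV, hK, hz⟩ := hf
    obtain ⟨M, hM⟩ := hK.exists_bound_of_continuousOn (hc.mono hKV)
    choose W hWo hWm hWi using hφ
    obtain ⟨t, ht⟩ := hK.elim_finite_subcover W hWo (fun g _ => mem_iUnion.2 ⟨g, hWm g⟩)
    refine ⟨t.card * M.toNNReal, fun u => ?_⟩
    have hpt : ∀ h : G, ‖f h‖ₑ ≤ ∑ i ∈ t, (W i).indicator (fun _ => ENNReal.ofReal M) h := by
      intro h
      by_cases hh : h ∈ K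
      · obtain ⟨i, hi, hiW⟩ := mem_iUnion₂.1 (ht hh)
        refine le_trans ?_ (Finset.single_le_sum (f := fun i =>
          (W i).indicator (fun _ => ENNReal.ofReal M) h) (fun _ _ => zero_le) hi)
        simp only [indicator_of_mem hiW]
        rw [← ofReal_norm]
        exact ENNReal.ofReal_le_ofReal (hM h hh)
      · simp [hz h hh]
    calc ∑' h : {h : G // φ h = u}, ‖f h‖ₑ
        ≤ ∑' h : {h : G // φ h = u}, ∑ i ∈ t, (W i).indicator (fun _ => ENNReal.ofReal M) (h : G) :=
          ENNReal.tsum_le_tsum fun h => hpt h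
      _ = ∑ i ∈ t, ∑' h : {h : G // φ h = u}, (W i).indicator (fun _ => ENNReal.ofReal M) (h : G) :=
          Summable.tsum_finsetSum fun _ _ => ENNReal.summable
      _ ≤ ∑ _i ∈ t, ENNReal.ofReal M := by
          refine Finset.sum_le_sum fun i _ => ?_
          by_cases hex : ∃ h : {h : G // φ h = u}, (h : G) ∈ W i
          · obtain ⟨h, hh⟩ := hex
            rw [tsum_eq_single h]
            · exact indicator_le_self' (fun _ _ => zero_le) _
            · intro h' hne
              refine indicator_of_notMem (fun hm => hne (Subtype.ext ?_)) _
              exact hWi i hm hh (h'.2.trans h.2.symm)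
          · push Not at hex
            rw [ENNReal.tsum_eq_zero.2 fun h => indicator_of_notMem (hex h) _]
            exact zero_le
      _ = _ := by simp [ENNReal.ofReal]
  | zero => exact ⟨0, fun u => by simp⟩
  | add f g _ _ hf hg =>
    obtain ⟨C, hC⟩ := hf
    obtain ⟨D, hD⟩ := hg
    refine ⟨C + D, fun u => ?_⟩
    calc _ ≤ ∑' h : {h : G // φ h = u}, (‖f h‖ₑ + ‖g h‖ₑ) :=
          ENNReal.tsum_le_tsum fun h => enorm_add_le _ _
      _ ≤ _ := by
          rw [ENNReal.tsum_add]
          push_cast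
          exact add_le_add (hC u) (hD u)
  | smul c f _ hf =>
    obtain ⟨C, hC⟩ := hf
    refine ⟨‖c‖₊ * C, fun u => ?_⟩
    simp only [Pi.smul_apply, smul_eq_mul, enorm_mul, ENNReal.tsum_mul_left]
    push_cast
    exact mul_le_mul' le_rfl (hC u)

lemma tsum_mul_sq_le {I : Type*} (a b : I → ℝ≥0∞) :
    (∑' i, a i * b i) ^ 2 ≤ (∑' i, a i) * ∑' i, a i * b i ^ 2 := by
  let _ : MeasurableSpace I := ⊤
  have h := ENNReal.lintegral_mul_le_Lp_mul_Lq (MeasureTheory.Measure.count : MeasureTheory.Measure I)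
    Real.HolderConjugate.two_two (f := fun i => a i ^ (1 / 2 : ℝ))
    (g := fun i => a i ^ (1 / 2 : ℝ) * b i) (measurable_from_top.aemeasurable)
    (measurable_from_top.aemeasurable)
  simp only [MeasureTheory.lintegral_count, Pi.mul_apply, ← mul_assoc] at h
  have e1 : ∀ x : ℝ≥0∞, x ^ (1 / 2 : ℝ) * x ^ (1 / 2 : ℝ) = x := fun x => by
    rw [← ENNReal.rpow_add_of_nonneg _ _ (by norm_num) (by norm_num)]; norm_num
  have e2 : ∀ x : ℝ≥0∞, (x ^ (1 / 2 : ℝ)) ^ (2 : ℝ) = x := fun x => by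
    rw [← ENNReal.rpow_mul]; norm_num
  simp only [ENNReal.mul_rpow_of_nonneg _ _ (show (0 : ℝ) ≤ 2 by norm_num), e1, e2,
    ENNReal.rpow_two] at h
  calc _ ≤ _ := pow_le_pow_left' h 2
    _ = _ := by
      rw [← ENNReal.mul_rpow_of_nonneg _ _ (by norm_num : (0 : ℝ) ≤ 1 / 2), ← ENNReal.rpow_two, e2]

/-- The Schur test. -/
lemma schur {I : Type*} {a : I → I → ℂ} {C : ℝ≥0} (hrow : ∀ i, ∑' j, ‖a i j‖ₑ ≤ C)
    (hcol : ∀ j, ∑' i, ‖a i j‖ₑ ≤ C) (ξ : I → ℂ) :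
    ∑' i, ‖∑' j, a i j * ξ j‖ₑ ^ 2 ≤ (C : ℝ≥0∞) ^ 2 * ∑' j, ‖ξ j‖ₑ ^ 2 := by
  calc ∑' i, ‖∑' j, a i j * ξ j‖ₑ ^ 2
      ≤ ∑' i, (C : ℝ≥0∞) * ∑' j, ‖a i j‖ₑ * ‖ξ j‖ₑ ^ 2 := by
        refine ENNReal.tsum_le_tsum fun i => ?_
        calc _ ≤ (∑' j, ‖a i j‖ₑ * ‖ξ j‖ₑ) ^ 2 := by
              refine pow_le_pow_left' ?_ 2
              simp only [← enorm_mul]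
              exact enorm_tsum_le_tsum_enorm
          _ ≤ _ := tsum_mul_sq_le _ _
          _ ≤ _ := mul_le_mul' (hrow i) le_rfl
    _ = (C : ℝ≥0∞) * ∑' j, (∑' i, ‖a i j‖ₑ) * ‖ξ j‖ₑ ^ 2 := by
        rw [ENNReal.tsum_mul_left, ENNReal.tsum_comm]
        simp only [ENNReal.tsum_mul_right]
    _ ≤ (C : ℝ≥0∞) * ∑' j, (C : ℝ≥0∞) * ‖ξ j‖ₑ ^ 2 :=
        mul_le_mul' le_rfl (ENNReal.tsum_le_tsum fun j => mul_le_mul' (hcol j) le_rfl)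
    _ = _ := by rw [ENNReal.tsum_mul_left, sq, mul_assoc]

lemma enorm_sq_eq {I : Type*} (ξ : Ell2 I) : ∑' i, ‖ξ i‖ₑ ^ 2 = ENNReal.ofReal (‖ξ‖ ^ 2) := by
  have h := lp.hasSum_norm (p := 2) (by norm_num) ξ
  simp only [ENNReal.toReal_ofNat, Real.rpow_two] at h
  rw [← h.tsum_eq, ENNReal.ofReal_tsum_of_nonneg (fun _ => by positivity) h.summable]
  refine tsum_congr fun i => ?_
  rw [ENNReal.ofReal_pow (norm_nonneg _), ofReal_norm]

lemma memℓp_two {I : Type*} {ξ : I → ℂ} (h : ∑' i, ‖ξ i‖ₑ ^ 2 ≠ ∞) : Memℓp ξ 2 := by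
  rw [memℓp_gen_iff (by norm_num)]
  simp only [ENNReal.toReal_ofNat, Real.rpow_two]
  have := ENNReal.summable_toReal h
  simpa using this

lemma summable_row {I : Type*} {a : I → I → ℂ} {C : ℝ≥0} (hrow : ∀ i, ∑' j, ‖a i j‖ₑ ≤ C)
    (ξ : Ell2 I) (i : I) : Summable fun j => a i j * ξ j := by
  have h1 : Summable fun j => ‖a i j‖ := by
    have := ENNReal.summable_toReal (ne_top_of_le_ne_top ENNReal.coe_ne_top (hrow i))
    simpa using this
  refine Summable.of_norm_bounded (h1.mul_right ‖ξ‖) fun j => ?_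
  rw [norm_mul]
  exact mul_le_mul_of_nonneg_left (lp.norm_apply_le_norm (by norm_num) ξ j) (norm_nonneg _)

section

variable {G : Type*} [ArrowGroupoid G] {x : UnitSpace G}

/-- For `g ∈ G_x`, the map `h ↦ h⁻¹ g` is a bijection of `G^{r(g)}` onto `G_x`, with inverse
`k ↦ g k⁻¹`. -/
def invMulEquiv (g : SrcFiber x) : RngFiber (rng (g : G)) ≃ SrcFiber x where
  toFun h := invMul g h
  invFun k := ⟨g * (k : G)⁻¹, by rw [rng_mul _ _ (by rw [rng_inv, g.2, k.2])]⟩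
  left_inv := by
    rintro ⟨h, hh⟩
    refine Subtype.ext ?_
    have e1 : src h⁻¹ = rng (g : G) := by rw [src_inv, hh]
    change (g : G) * (h⁻¹ * g)⁻¹ = h
    set k := h⁻¹ * (g : G) with hk
    have hks : src k = src (g : G) := src_mul _ _ e1
    have hkr : rng k = src h := by rw [hk, rng_mul _ _ e1, rng_inv]
    have e2 : h * k = g := by
      rw [hk, ← mul_assoc' _ _ _ (by rw [rng_inv]) e1, mul_inv_self, hh, rng_mul_self]
    have e3 : (g : G) * k⁻¹ = h * k * k⁻¹ := by rw [e2]
    rw [e3, mul_assoc' _ _ _ hkr.symm (by rw [rng_inv]), mul_inv_self, hkr, mul_src]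
  right_inv := by
    rintro ⟨k, hk⟩
    refine Subtype.ext ?_
    have e1 : src (g : G) = rng k⁻¹ := by rw [rng_inv, g.2, hk]
    change ((g : G) * k⁻¹)⁻¹ * g = k
    set m := (g : G) * k⁻¹ with hm
    have hms : src m = rng k := by rw [hm, src_mul _ _ e1, src_inv]
    have e2 : m * k = g := by
      rw [hm, mul_assoc' _ _ _ e1 (by rw [src_inv]), inv_mul_self, hk.trans g.2.symm, mul_src]
    have e3 : m⁻¹ * (g : G) = m⁻¹ * (m * k) := by rw [e2]
    rw [e3, ← mul_assoc' _ _ _ (by rw [src_inv]) hms, inv_mul_self, hms, rng_mul_self]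

/-- The matrix of `ρ_x(f)` in the standard basis. -/
def kernel (f : G → ℂ) (g k : SrcFiber x) : ℂ := f (g * (k : G)⁻¹)

lemma tsum_eq (f : G → ℂ) (ξ : SrcFiber x → ℂ) (g : SrcFiber x) :
    ∑' h : RngFiber (rng (g : G)), f h * ξ (invMul g h) = ∑' k, kernel f g k * ξ k := by
  rw [← (invMulEquiv g).symm.tsum_eq]
  refine tsum_congr fun k => ?_
  have : invMul g ((invMulEquiv g).symm k) = k := (invMulEquiv g).apply_symm_apply k
  rw [this]
  rfl

lemma kernel_row {f : G → ℂ} {C : ℝ≥0} (hC : FiberBdd (rng : G → G) f C) (g : SrcFiber x) :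
    ∑' k, ‖kernel f g k‖ₑ ≤ C := by
  refine le_trans (le_of_eq ?_) (hC (rng (g : G)))
  rw [← (invMulEquiv g).symm.tsum_eq]
  rfl

lemma kernel_col {f : G → ℂ} {C : ℝ≥0} (hC : FiberBdd (src : G → G) f C) (k : SrcFiber x) :
    ∑' g, ‖kernel f g k‖ₑ ≤ C := by
  have e : ∀ g : SrcFiber x, src (g : G) = rng (k : G)⁻¹ := fun g => by rw [rng_inv, g.2, k.2]
  let φ : SrcFiber x → {h : G // src h = rng (k : G)} := fun g =>
    ⟨g * (k : G)⁻¹, by rw [src_mul _ _ (e g), src_inv]⟩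
  have hφ : Function.Injective φ := by
    intro g g' hgg
    have h1 : (g : G) * (k : G)⁻¹ = g' * (k : G)⁻¹ := congrArg Subtype.val hgg
    have h2 : ∀ g : SrcFiber x, (g : G) * (k : G)⁻¹ * k = g := fun g => by
      rw [mul_assoc' _ _ _ (e g) (by rw [src_inv]), inv_mul_self, k.2.trans g.2.symm, mul_src]
    exact Subtype.ext (by rw [← h2 g, h1, h2 g'])
  exact (ENNReal.tsum_comp_le_tsum_of_injective hφ (fun h => ‖f h‖ₑ)).trans (hC _)

end

lemma exists_bound {G : Type*} [TopologicalSpace G] [EtaleGroupoid G] (f : Cc G) :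
    ∃ C, FiberBdd (src : G → G) f C ∧ FiberBdd (rng : G → G) f C := by
  obtain ⟨C, hC⟩ := exists_fiberBdd (φ := (src : G → G)) (fun g => by
    obtain ⟨W, hW, hg, hi⟩ :=
      (EtaleGroupoid.isLocalHomeomorph_src (G := G)).isLocallyInjective g
    exact ⟨W, hW, hg, fun a ha b hb hab => hi ha hb (Subtype.ext hab)⟩) f.2
  obtain ⟨D, hD⟩ := exists_fiberBdd (φ := (rng : G → G)) (fun g => by
    obtain ⟨W, hW, hg, hi⟩ :=
      (EtaleGroupoid.isLocalHomeomorph_rng (G := G)).isLocallyInjective g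
    exact ⟨W, hW, hg, fun a ha b hb hab => hi ha hb (Subtype.ext hab)⟩) f.2
  exact ⟨max C D, fun u => (hC u).trans (by exact_mod_cast le_max_left C D),
    fun u => (hD u).trans (by exact_mod_cast le_max_right C D)⟩

end RegBound

/-- The C⋆-subalgebra generated by a subset of a C⋆-algebra. -/
def generatedCStar {B : Type*} [NonUnitalCStarAlgebra B] (S : Set B) :
    NonUnitalStarSubalgebra ℂ B :=
  (NonUnitalStarAlgebra.adjoin ℂ S).topologicalClosure

lemma isClosed_generatedCStar {B : Type*} [NonUnitalCStarAlgebra B] (S : Set B) :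
    IsClosed (generatedCStar S : Set B) :=
  NonUnitalStarSubalgebra.isClosed_topologicalClosure _

/-! ### The regular representations and the reduced C⋆-algebra -/

section Reduced

variable {G : Type*} [TopologicalSpace G] [EtaleGroupoid G]

/-- The function `ρ_x(f) ξ` on `G_x`, given by
`(ρ_x(f) ξ)(g) = ∑_{h ∈ G^{r(g)}} f(h) ξ(h⁻¹ g)`; for `f ∈ C_c(G)` only finitely many summands are
nonzero. -/
def regFun (f : Cc G) (x : UnitSpace G) (ξ : SrcFiber x → ℂ) (g : SrcFiber x) : ℂ :=
  ∑' h : RngFiber (rng (g : G)), (f : G → ℂ) h * ξ (invMul g h)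

lemma regFun_bound {f : Cc G} {C : ℝ≥0}
    (hC : RegBound.FiberBdd (src : G → G) f C ∧ RegBound.FiberBdd (rng : G → G) f C)
    (x : UnitSpace G) (ξ : Ell2 (SrcFiber x)) :
    ∑' g, ‖regFun f x ξ g‖ₑ ^ 2 ≤ ENNReal.ofReal ((C * ‖ξ‖) ^ 2) := by
  have h := RegBound.schur (fun g => RegBound.kernel_row (x := x) hC.2 g)
    (RegBound.kernel_col hC.1) ξ
  rw [RegBound.enorm_sq_eq] at h
  simp only [regFun, RegBound.tsum_eq]
  refine h.trans (le_of_eq ?_)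
  rw [mul_pow, ENNReal.ofReal_mul (by positivity), ENNReal.ofReal_pow C.coe_nonneg,
    ENNReal.ofReal_coe_nnreal]

lemma memℓp_regFun (f : Cc G) (x : UnitSpace G) (ξ : Ell2 (SrcFiber x)) :
    Memℓp (regFun f x ξ) 2 := by
  obtain ⟨C, hC⟩ := RegBound.exists_bound f
  exact RegBound.memℓp_two (ne_top_of_le_ne_top ENNReal.ofReal_ne_top (regFun_bound hC x ξ))

lemma regFun_norm_le {f : Cc G} {C : ℝ≥0}
    (hC : RegBound.FiberBdd (src : G → G) f C ∧ RegBound.FiberBdd (rng : G → G) f C)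
    (x : UnitSpace G) (ξ : Ell2 (SrcFiber x)) :
    ‖(⟨regFun f x ξ, memℓp_regFun f x ξ⟩ : Ell2 (SrcFiber x))‖ ≤ C * ‖ξ‖ := by
  have h := regFun_bound hC x ξ
  have h2 := RegBound.enorm_sq_eq (⟨regFun f x ξ, memℓp_regFun f x ξ⟩ : Ell2 (SrcFiber x))
  rw [← abs_of_nonneg (show (0 : ℝ) ≤ C * ‖ξ‖ by positivity)]
  refine (abs_le_of_sq_le_sq' ?_ (by positivity)).2
  rw [sq_abs]
  refine (ENNReal.ofReal_le_ofReal_iff (by positivity)).1 ?_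
  rw [← h2]
  exact h

/-- The bounded operator `ρ_x(f)` on `ℓ²(G_x)`. -/
def regOp (f : Cc G) (x : UnitSpace G) : Ell2 (SrcFiber x) →L[ℂ] Ell2 (SrcFiber x) :=
  LinearMap.mkContinuousOfExistsBound
    { toFun := fun ξ => ⟨regFun f x ξ, memℓp_regFun f x ξ⟩
      map_add' := fun ξ η => by
        obtain ⟨C, hC⟩ := RegBound.exists_bound f
        refine lp.ext (funext fun g => ?_)
        change regFun f x (fun k => ξ k + η k) g = regFun f x ξ g + regFun f x η g
        simp only [regFun]
        rw [RegBound.tsum_eq _ (fun k => ξ k + η k), RegBound.tsum_eq _ ξ, RegBound.tsum_eq _ η]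
        simp only [mul_add]
        exact Summable.tsum_add (RegBound.summable_row (RegBound.kernel_row hC.2) ξ g)
          (RegBound.summable_row (RegBound.kernel_row hC.2) η g)
      map_smul' := fun c ξ => by
        refine lp.ext (funext fun g => ?_)
        simp only [lp.coeFn_smul, Pi.smul_apply, regFun, smul_eq_mul, RingHom.id_apply,
          mul_left_comm _ c]
        exact tsum_mul_left }
    (by
      obtain ⟨C, hC⟩ := RegBound.exists_bound f
      exact ⟨C, regFun_norm_le hC x⟩)

lemma memℓp_regOp (f : Cc G) : Memℓp (fun x : UnitSpace G => regOp f x) ∞ := by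
  obtain ⟨C, hC⟩ := RegBound.exists_bound f
  refine memℓp_infty ⟨C, ?_⟩
  rintro _ ⟨x, rfl⟩
  exact ContinuousLinearMap.opNorm_le_bound _ C.2 (regFun_norm_le hC x)

variable (G) in
/-- The C⋆-algebra `∏_x B(ℓ²(G_x))` of bounded families of operators, with the supremum norm. -/
def FiberOps : Type _ :=
  lp (fun x : UnitSpace G => Ell2 (SrcFiber x) →L[ℂ] Ell2 (SrcFiber x)) ∞

instance : NonUnitalCStarAlgebra (FiberOps G) :=
  inferInstanceAs (NonUnitalCStarAlgebra
    (lp (fun x : UnitSpace G => Ell2 (SrcFiber x) →L[ℂ] Ell2 (SrcFiber x)) ∞))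

/-- The coordinate projection `∏_z B(ℓ²(G_z)) → B(ℓ²(G_x))`. -/
def FiberOps.eval (x : UnitSpace G) :
    FiberOps G →⋆ₙₐ[ℂ] (Ell2 (SrcFiber x) →L[ℂ] Ell2 (SrcFiber x)) where
  toFun a := a.1 x
  map_smul' _ _ := rfl
  map_zero' := rfl
  map_add' _ _ := rfl
  map_mul' _ _ := rfl
  map_star' _ := rfl

/-- The family `(ρ_x(f))_x`.  Its norm is the reduced norm `‖f‖_r = sup_x ‖ρ_x(f)‖`. -/
def regFamily (f : Cc G) : FiberOps G := ⟨fun x => regOp f x, memℓp_regOp f⟩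

variable (G) in
/-- The reduced C⋆-algebra `C⋆_r(G)`, realised as the C⋆-algebra generated by the families
`(ρ_x(f))_x`, `f ∈ C_c(G)`, in `∏_x B(ℓ²(G_x))`.  (As `C_c(G)` is a ⋆-algebra under convolution and
the `ρ_x` are ⋆-representations, this is the closure of the image of `C_c(G)`, that is, the
completion of `C_c(G)` in the reduced norm.) -/
def ReducedCStar : NonUnitalStarSubalgebra ℂ (FiberOps G) :=
  generatedCStar (Set.range (regFamily : Cc G → FiberOps G))

instance : IsClosed (ReducedCStar G : Set (FiberOps G)) := isClosed_generatedCStar _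

instance : NonUnitalCStarAlgebra (ReducedCStar G) :=
  NonUnitalStarSubalgebra.nonUnitalCStarAlgebra _

/-- The representation `ρ_x` of `C⋆_r(G)` on `ℓ²(G_x)`. -/
def regRep (x : UnitSpace G) :
    ReducedCStar G →⋆ₙₐ[ℂ] (Ell2 (SrcFiber x) →L[ℂ] Ell2 (SrcFiber x)) :=
  (FiberOps.eval x).comp (NonUnitalStarSubalgebraClass.subtype (ReducedCStar G))

end Reduced

/-! ### Direct sums and weak containment of representations -/

section Representations

variable {A : Type*} [NonUnitalCStarAlgebra A]

/-- The Hilbert space direct sum `⊕_i σ_i` of a family of representations of a C⋆-algebra. -/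
def directSumRep {ι : Type*} {H : ι → Type*} [∀ i, NormedAddCommGroup (H i)]
    [∀ i, InnerProductSpace ℂ (H i)] [∀ i, CompleteSpace (H i)]
    (σ : ∀ i, A →⋆ₙₐ[ℂ] (H i →L[ℂ] H i)) : A →⋆ₙₐ[ℂ] (lp H 2 →L[ℂ] lp H 2) where
  toFun a := lp.mapCLM 2 (fun i => σ i a) (norm_nonneg a)
    (fun i => NonUnitalStarAlgHom.norm_apply_le (σ i) a)
  map_smul' c a := by ext ξ i; simp
  map_zero' := by ext ξ i; simp
  map_add' a b := by ext ξ i; simp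
  map_mul' a b := by ext ξ i; simp
  map_star' a := by
    rw [ContinuousLinearMap.star_eq_adjoint, ContinuousLinearMap.eq_adjoint_iff]
    intro ξ η
    simp only [lp.inner_eq_tsum]
    refine tsum_congr fun i => ?_
    simp [map_star, ContinuousLinearMap.star_eq_adjoint, ContinuousLinearMap.adjoint_inner_left]

/-- A representation `π` of a C⋆-algebra is weakly contained in `σ` if `ker σ ⊆ ker π`
(equivalently, if `‖π(a)‖ ≤ ‖σ(a)‖` for all `a`). -/
def WeaklyContained {H K : Type*} [NormedAddCommGroup H] [InnerProductSpace ℂ H] [CompleteSpace H]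
    [NormedAddCommGroup K] [InnerProductSpace ℂ K] [CompleteSpace K]
    (π : A →⋆ₙₐ[ℂ] (H →L[ℂ] H)) (σ : A →⋆ₙₐ[ℂ] (K →L[ℂ] K)) : Prop :=
  ∀ a : A, σ a = 0 → π a = 0

end Representations

end

open ArrowGroupoid

/-! The non-Hausdorff topology drives the argument. A unit `z` in `U k` that is close to `x` is also
close to `g k`, and, since `z = z * z`, to every power of `g k`. Choose finite `N k`, equal to the
order of `g k` when that is finite and large otherwise, with `∑ 1 / N k < 1`. Let `v k` be the
average of bump functions in bisections around `(g k) ^ j`, `j < N k`. On the fibre over `x` these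
bumps see `N k` distinct arrows, so `ρ_x(v k) δ_x` has squared norm `1 / N k`. At a unit `z ∈ U k`
near `x` they all equal `1` and have no other arrow with range `z` in their supports, so `v k` acts
as the identity there (`exists_average`).

Let `f` be a bump at `x` supported on units near `x`. For `y ∈ Y`, invariance and the covering of
`Y` near `x` by the `U k` give `ρ_y(f⋆ f) ≤ ∑ ρ_y(v_k⋆ v_k)` (`norm_regOp_sq_le`), while testing on
`δ_x` shows that this fails for `ρ_x`. Thus the negative part of `∑ v_k⋆ v_k - f⋆ f` is killed by
every `ρ_y`, `y ∈ Y`, but not by `ρ_x`. -/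

section

/-! ### Positivity as a kernel condition -/

variable {A B : Type*} [NonUnitalCStarAlgebra A] [CStarAlgebra B] [PartialOrder B]
  [StarOrderedRing B]

/-- Homomorphisms commute with the functional calculus, so `π a⁻ = (π a)⁻`. With the converse below,
positivity of `π a` becomes membership of `a⁻` in the kernel, the only data weak containment
controls. -/
lemma NonUnitalStarAlgHom.map_negPart_eq_zero (π : A →⋆ₙₐ[ℂ] B) {a : A} (ha : IsSelfAdjoint a)
    (h : 0 ≤ π a) : π a⁻ = 0 := by
  have hπ : π a⁻ = (π a)⁻ := by
    rw [CFC.negPart_def, CFC.negPart_def]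
    exact π.map_cfcₙ _ a
      (hφ := AddMonoidHomClass.continuous_of_bound π 1 fun c => by
        simpa using NonUnitalStarAlgHom.norm_apply_le π c) (ha := ha) (hφa := ha.map π)
  rwa [hπ, CFC.negPart_eq_zero_iff _ (ha.map π)]

lemma NonUnitalStarAlgHom.map_nonneg_of_map_negPart_eq_zero (π : A →⋆ₙₐ[ℂ] B) {a : A}
    (ha : IsSelfAdjoint a) (h : π a⁻ = 0) : 0 ≤ π a := by
  have hπ : π a⁺ = (π a)⁺ := by
    rw [CFC.posPart_def, CFC.posPart_def]
    exact π.map_cfcₙ _ a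
      (hφ := AddMonoidHomClass.continuous_of_bound π 1 fun c => by
        simpa using NonUnitalStarAlgHom.norm_apply_le π c) (ha := ha) (hφa := ha.map π)
  rw [← CFC.posPart_sub_negPart a ha, map_sub, h, sub_zero, hπ]
  exact CFC.posPart_nonneg _

end

/-! ### Bump functions on a non-Hausdorff space -/

/-- Urysohn's lemma inside the Hausdorff set `O`. The extension by zero need not be continuous on
`X`, so the value `1` on a whole neighbourhood of `g` is recorded: limits are taken along points of
`X`. -/
lemma exists_bump_subset {X : Type*} [TopologicalSpace X] [LocallyCompactSpace X] {O : Set X}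
    [T2Space O] (hO : IsOpen O) {g : X} (hg : g ∈ O) :
    ∃ b ∈ Cc X, (∀ h ∉ O, b h = 0) ∧ (∀ h, ‖b h‖ ≤ 1) ∧ ∀ᶠ h in 𝓝 g, b h = 1 := by
  classical
  have : LocallyCompactSpace O := hO.locallyCompactSpace
  obtain ⟨k, hk, hkg⟩ := exists_compact_mem_nhds (⟨g, hg⟩ : O)
  obtain ⟨F, hF1, -, hFc, hF⟩ := exists_continuous_one_zero_of_isCompact hk isClosed_empty
    (disjoint_empty k)
  let b : X → ℂ := fun h => if hh : h ∈ O then (F ⟨h, hh⟩ : ℂ) else 0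
  have hb : ∀ h : O, b h = F h := fun h => by simp [b]
  refine ⟨b, Submodule.subset_span ⟨O, hO, inferInstance, ?_, Subtype.val '' tsupport F, ?_,
    hFc.image continuous_subtype_val, ?_⟩, ?_, ?_, ?_⟩
  · rw [continuousOn_iff_continuous_domRestrict]
    have : O.domRestrict b = fun h => (F h : ℂ) := funext hb
    rw [this]
    fun_prop
  · rintro _ ⟨h, -, rfl⟩
    exact h.2
  · intro h hh
    by_cases hO' : h ∈ O
    · rw [hb ⟨h, hO'⟩, image_eq_zero_of_notMem_tsupport fun hm => hh ⟨_, hm, rfl⟩]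
      simp
    · simp [b, hO']
  · intro h hh
    simp [b, hh]
  · intro h
    by_cases hO' : h ∈ O
    · rw [hb ⟨h, hO'⟩, Complex.norm_real, Real.norm_of_nonneg (hF _).1]
      exact (hF _).2
    · simp [b, hO']
  · have := hO.isOpenEmbedding_subtypeVal.map_nhds_eq ⟨g, hg⟩
    rw [← show _ = 𝓝 g from this, Filter.eventually_map]
    filter_upwards [hkg] with h hh
    rw [hb, hF1 hh]
    simp

/-! ### Open bisections, units, and point masses -/

section

variable {G : Type*} [TopologicalSpace G] [EtaleGroupoid G]

lemma continuous_src : Continuous (src : G → G) :=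
  continuous_subtype_val.comp (EtaleGroupoid.isLocalHomeomorph_src (G := G)).continuous

lemma continuous_rng : Continuous (rng : G → G) :=
  continuous_subtype_val.comp (EtaleGroupoid.isLocalHomeomorph_rng (G := G)).continuous

lemma exists_isOpenBisection (g : G) : ∃ B : Set G, IsOpenBisection B ∧ g ∈ B := by
  obtain ⟨V, hV, hgV, hiV⟩ := (EtaleGroupoid.isLocalHomeomorph_src (G := G)).isLocallyInjective g
  obtain ⟨W, hW, hgW, hiW⟩ := (EtaleGroupoid.isLocalHomeomorph_rng (G := G)).isLocallyInjective g
  exact ⟨V ∩ W, ⟨hV.inter hW, fun a ha b hb h => hiV ha.1 hb.1 (Subtype.ext h),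
    fun a ha b hb h => hiW ha.2 hb.2 (Subtype.ext h)⟩, hgV, hgW⟩

lemma IsOpenBisection.mono {B B' : Set G} (hB : IsOpenBisection B) (hB' : IsOpen B')
    (h : B' ⊆ B) : IsOpenBisection B' :=
  ⟨hB', hB.2.1.mono h, hB.2.2.mono h⟩

/-- The source map embeds `B` injectively and continuously in the Hausdorff unit space. -/
lemma IsOpenBisection.t2Space {B : Set G} (hB : IsOpenBisection B) : T2Space B := by
  have := EtaleGroupoid.t2_units (G := G)
  refine T2Space.of_injective_continuous (f := fun b : B => srcMap (b : G)) ?_ ?_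
  · intro a b h
    exact Subtype.ext (hB.2.1 a.2 b.2 (congrArg Subtype.val h))
  · exact (EtaleGroupoid.isLocalHomeomorph_src (G := G)).continuous.comp continuous_subtype_val

/-- The inverse of the source map on an open bisection is continuous. -/
lemma IsOpenBisection.tendsto_of_src {B : Set G} (hB : IsOpenBisection B) {g : G} (hg : g ∈ B)
    {ι : Type*} {l : Filter ι} {u : ι → G} (hu : ∀ᶠ i in l, u i ∈ B)
    (h : Filter.Tendsto (fun i => srcMap (u i)) l (𝓝 (srcMap g))) : Filter.Tendsto u l (𝓝 g) := by
  refine Filter.tendsto_def.2 fun O hO => ?_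
  -- As `srcMap` is open, `u i` eventually shares its source with an arrow of `O ∩ B`; injectivity
  -- on `B` makes the two equal.
  have hmem : srcMap '' (O ∩ B) ∈ 𝓝 (srcMap g) :=
    (EtaleGroupoid.isLocalHomeomorph_src (G := G)).isOpenMap.image_mem_nhds
      (Filter.inter_mem hO (hB.1.mem_nhds hg))
  filter_upwards [hu, h.eventually_mem hmem] with i hi hi'
  obtain ⟨c, hc, hce⟩ := hi'
  rw [mem_preimage, ← hB.2.1 hc.2 hi (congrArg Subtype.val hce)]
  exact hc.1

/-- If `g` and `src g` lie in the same bisection, they have the same source and so coincide. -/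
lemma exists_isOpen_subset_units (x : UnitSpace G) :
    ∃ O : Set G, IsOpen O ∧ (x : G) ∈ O ∧ ∀ g ∈ O, src g = g := by
  obtain ⟨B, hB, hx⟩ := exists_isOpenBisection (x : G)
  refine ⟨B ∩ src ⁻¹' B, hB.1.inter (hB.1.preimage continuous_src), ⟨hx, ?_⟩, fun g hg => ?_⟩
  · rwa [mem_preimage, x.2]
  · exact hB.2.1 hg.2 hg.1 (src_src g)

lemma inv_unit (x : UnitSpace G) : (x : G)⁻¹ = x := by
  have h := mul_src (x : G)⁻¹
  rw [src_inv, rng_unit] at h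
  exact h.symm.trans ((inv_mul_self (x : G)).trans x.2)

lemma rng_inv_mul_self (g : G) : (rng g)⁻¹ * g = g :=
  (congrArg (· * g) (inv_unit (rngMap g))).trans (rng_mul_self g)

lemma mul_inv_unit {x : UnitSpace G} (g : SrcFiber x) : (g : G) * (x : G)⁻¹ = g := by
  have h := mul_src (g : G)
  rw [g.2] at h
  rw [inv_unit, h]

lemma regFun_eq_of_support {f : Cc G} {y : UnitSpace G} (ξ : SrcFiber y → ℂ) (g : SrcFiber y)
    (hf : ∀ h : G, rng h = rng (g : G) → h ≠ rng (g : G) → (f : G → ℂ) h = 0) :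
    regFun f y ξ g = (f : G → ℂ) (rng (g : G)) * ξ g := by
  rw [regFun, tsum_eq_single ⟨rng (g : G), rng_rng _⟩]
  · congr 2
    exact Subtype.ext (rng_inv_mul_self _)
  · intro h hne
    rw [hf h h.2 fun he => hne (Subtype.ext he), zero_mul]

/-- Reduces the norm of `ρ_x(f) δ_x` to the values of `f` on the fibre `G_x`. -/
lemma regOp_single (f : Cc G) (x : UnitSpace G) [DecidableEq (SrcFiber x)] (g : SrcFiber x) :
    regOp f x (lp.single 2 ⟨x, x.2⟩ 1) g = (f : G → ℂ) g := by
  change regFun f x _ g = _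
  rw [regFun, RegBound.tsum_eq, tsum_eq_single ⟨(x : G), x.2⟩]
  · rw [lp.single_apply_self, mul_one, RegBound.kernel, mul_inv_unit]
  · intro k hk
    rw [lp.single_apply_ne _ _ _ hk, mul_zero]

end

lemma hasSum_norm_sq {I : Type*} (ξ : Ell2 I) : HasSum (fun i => ‖ξ i‖ ^ 2) (‖ξ‖ ^ 2) := by
  have h := lp.hasSum_norm (p := 2) (by norm_num) ξ
  simpa only [ENNReal.toReal_ofNat, Real.rpow_two] using h

/-! ### Replacing the orders by finite numbers -/

/-- Elements of infinite order all get one exponent `M`, so large that `card ι / M` is less than the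
slack `1 - S` in the hypothesis. -/
lemma exists_pow_injOn {ι : Type*} [Fintype ι] {Γ : Type*} [Group Γ] (g : ι → Γ)
    (hord : ∑ k, 1 / (orderOf (g k) : ℝ) < 1) :
    ∃ N : ι → ℕ, (∀ k, 0 < N k) ∧ (∀ k, InjOn (fun j => g k ^ j) (Iio (N k))) ∧
      ∑ k, 1 / (N k : ℝ) < 1 := by
  classical
  set S := ∑ k, 1 / (orderOf (g k) : ℝ)
  obtain ⟨M, hM⟩ := exists_nat_gt (Fintype.card ι / (1 - S))
  have hS : 0 < 1 - S := by linarith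
  have hM0 : (0 : ℝ) < M := lt_of_le_of_lt (by positivity) hM
  refine ⟨fun k => if orderOf (g k) = 0 then M else orderOf (g k), fun k => ?_, fun k => ?_, ?_⟩
  · dsimp only
    split_ifs with h
    · exact_mod_cast hM0
    · exact Nat.pos_of_ne_zero h
  · dsimp only
    split_ifs with h
    · rw [orderOf_eq_zero_iff] at h
      exact (injective_pow_iff_not_isOfFinOrder.2 h).injOn
    · exact pow_injOn_Iio_orderOf
  · calc _ ≤ ∑ k, (1 / (orderOf (g k) : ℝ) + 1 / M) := by
          refine Finset.sum_le_sum fun k _ => ?_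
          dsimp only
          split_ifs with h
          · simp [h]
          · simp
      _ = S + Fintype.card ι / M := by
          rw [Finset.sum_add_distrib, Finset.sum_const, Finset.card_univ, nsmul_eq_mul,
            mul_one_div]
      _ < 1 := by
          rw [div_lt_iff₀ hS] at hM
          have : (Fintype.card ι : ℝ) / M < 1 - S := by
            rw [div_lt_iff₀ hM0]
            linarith
          linarith

/-! ### Averages over powers of an isotropy element -/

section

variable {G : Type*} [TopologicalSpace G] [EtaleGroupoid G]

/-- A bump function in `C_c(G)` around an arrow, supported in a small open bisection. -/
lemma exists_bump (g : G) {O : Set G} (hO : IsOpen O) (hg : g ∈ O) :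
    ∃ (b : Cc G) (B : Set G), IsOpenBisection B ∧ g ∈ B ∧ B ⊆ O ∧
      (∀ h ∉ B, (b : G → ℂ) h = 0) ∧ (∀ h, ‖(b : G → ℂ) h‖ ≤ 1) ∧
      ∀ᶠ h in 𝓝 g, (b : G → ℂ) h = 1 := by
  have := EtaleGroupoid.locallyCompact (G := G)
  obtain ⟨B, hB, hgB⟩ := exists_isOpenBisection g
  have hB' := hB.mono (hB.1.inter hO) inter_subset_left
  have := hB'.t2Space
  obtain ⟨b, hb, h⟩ := exists_bump_subset hB'.1 (g := g) ⟨hgB, hg⟩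
  exact ⟨⟨b, hb⟩, B ∩ O, hB', ⟨hgB, hg⟩, inter_subset_right, h⟩

/-- Units in an open bisection around an isotropy element `γ` that converge to the base point `x`
converge to every power of `γ`. -/
lemma tendsto_units_pow {x : UnitSpace G} (γ : Isotropy x) {V : Set G} (hV : IsOpenBisection V)
    (hγ : γ.1 ∈ V) (j : ℕ) :
    Filter.Tendsto (fun z : UnitSpace G => (z : G)) (𝓝[{z | (z : G) ∈ V}] x) (𝓝 (γ ^ j).1) := by
  have hs : ∀ z : UnitSpace G, srcMap (z : G) = z := fun z => Subtype.ext z.2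
  have h1 : Filter.Tendsto (fun z : UnitSpace G => (z : G)) (𝓝[{z | (z : G) ∈ V}] x)
      (𝓝 γ.1) := by
    refine hV.tendsto_of_src hγ self_mem_nhdsWithin ?_
    simp only [hs]
    rw [show srcMap γ.1 = x from Subtype.ext γ.2.1]
    exact nhdsWithin_le_nhds
  induction j with
  | zero =>
    rw [pow_zero]
    exact continuous_subtype_val.continuousAt.tendsto.mono_left nhdsWithin_le_nhds
  | succ j ih =>
    rw [pow_succ]
    have hm : ((γ ^ j).1, γ.1) ∈ {p : G × G | src p.1 = rng p.2} := by
      change src (γ ^ j).1 = rng γ.1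
      rw [(γ ^ j).2.1, γ.2.2]
    have hc := (EtaleGroupoid.continuousOn_mul (G := G)) _ hm
    have ht : Filter.Tendsto (fun z : UnitSpace G => ((z : G), (z : G)))
        (𝓝[{z | (z : G) ∈ V}] x) (𝓝[{p : G × G | src p.1 = rng p.2}] ((γ ^ j).1, γ.1)) :=
      tendsto_nhdsWithin_iff.2 ⟨ih.prodMk_nhds h1, Filter.Eventually.of_forall fun z => by
        rw [mem_ofPred_eq, z.2, rng_unit]⟩
    -- Since `z = z * z` for a unit, continuity of the product at `(γ ^ j, γ)` gives the next power.
    refine (hc.tendsto.comp ht).congr fun z => ?_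
    have := mul_src (z : G)
    rwa [z.2] at this

/-- An element of `C_c(G)` averaging the first `N` powers of an isotropy element `γ`, which acts as
the identity at the units close to `x` in an open bisection around `γ`. -/
lemma exists_average {x : UnitSpace G} [DecidableEq (SrcFiber x)] (γ : Isotropy x) {N : ℕ}
    (hN : 0 < N) (hγ : InjOn (fun j => γ ^ j) (Iio N)) {V : Set G} (hV : IsOpenBisection V)
    (hγV : γ.1 ∈ V) :
    ∃ v : Cc G, ‖regOp v x (lp.single 2 ⟨x, x.2⟩ 1)‖ ^ 2 = 1 / (N : ℝ) ∧
      ∀ᶠ z : UnitSpace G in 𝓝 x, (z : G) ∈ V →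
        (v : G → ℂ) z = 1 ∧ ∀ h : G, rng h = z → h ≠ z → (v : G → ℂ) h = 0 := by
  classical
  have hN' : (N : ℂ) ≠ 0 := by exact_mod_cast hN.ne'
  choose b B hB hgB _ hb0 _ hb1 using
    fun j : Fin N => exists_bump (γ ^ (j : ℕ)).1 isOpen_univ (mem_univ _)
  have hv : ∀ h : G, (((N : ℂ)⁻¹ • ∑ j, b j : Cc G) : G → ℂ) h =
      (N : ℂ)⁻¹ * ∑ j, (b j : G → ℂ) h := fun h => by simp
  refine ⟨(N : ℂ)⁻¹ • ∑ j, b j, ?_, ?_⟩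
  · let p : Fin N → SrcFiber x := fun j => ⟨(γ ^ (j : ℕ)).1, (γ ^ (j : ℕ)).2.1⟩
    have hp : Function.Injective p := fun i j hij =>
      Fin.ext (hγ i.2 j.2 (Subtype.ext (Subtype.ext_iff.1 hij :)))
    -- The bisection `B j` meets `G_x` only in `γ ^ j`.
    have hbp : ∀ (j : Fin N) (g : SrcFiber x), (b j : G → ℂ) g = if g = p j then 1 else 0 := by
      intro j g
      split_ifs with h
      · rw [h]
        exact (hb1 j).self_of_nhds
      · refine hb0 j _ fun hg => h (Subtype.ext ?_)
        exact (hB j).2.1 hg (hgB j) (g.2.trans (p j).2.symm)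
    rw [← (hasSum_norm_sq _).tsum_eq]
    simp only [regOp_single, hv, hbp]
    rw [← hp.tsum_eq]
    · simp only [hp.eq_iff, Finset.sum_ite_eq, Finset.mem_univ, if_true, tsum_fintype]
      rw [Finset.sum_const, Finset.card_univ, Fintype.card_fin, nsmul_eq_mul]
      simp
      field_simp
    · intro g hg
      by_contra hne
      refine hg ?_
      dsimp only
      rw [Finset.sum_eq_zero fun j _ => if_neg fun h => hne ⟨j, h.symm⟩]
      simp
  · have : ∀ᶠ z : UnitSpace G in 𝓝[{z | (z : G) ∈ V}] x, ∀ j, (b j : G → ℂ) z = 1 :=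
      Filter.eventually_all.2 fun j => (tendsto_units_pow γ hV hγV j).eventually (hb1 j)
    filter_upwards [eventually_nhdsWithin_iff.1 this] with z hz hzV
    have hz1 := hz hzV
    refine ⟨by simp [hv, hz1, hN'], fun h hr hne => ?_⟩
    rw [hv, Finset.sum_eq_zero, mul_zero]
    intro j _
    -- The unit `z` lies in `B j` because `b j z = 1`, so injectivity of the range on `B j` excludes
    -- any other arrow with range `z`.
    refine hb0 j h fun hm => hne ((hB j).2.2 hm ?_ (hr.trans (rng_unit z).symm))
    by_contra hzB
    exact one_ne_zero ((hz1 j).symm.trans (hb0 j _ hzB))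

/-! ### Operator inequalities as comparisons of norms -/

/-- The reduced C⋆-algebra element given by `f ∈ C_c(G)`. -/
noncomputable def reducedOf (f : Cc G) : ReducedCStar G :=
  ⟨regFamily f, NonUnitalStarSubalgebra.le_topologicalClosure _
    (NonUnitalStarAlgebra.subset_adjoin ℂ _ ⟨f, rfl⟩)⟩

lemma regRep_reducedOf (f : Cc G) (x : UnitSpace G) : regRep x (reducedOf f) = regOp f x := rfl

/-- `∑ v_k⋆ v_k - f⋆ f` in the reduced C⋆-algebra. -/
noncomputable def sqDiff {ι : Type*} [Fintype ι] (v : ι → Cc G) (f : Cc G) : ReducedCStar G :=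
  ∑ k, star (reducedOf (v k)) * reducedOf (v k) - star (reducedOf f) * reducedOf f

lemma isSelfAdjoint_sqDiff {ι : Type*} [Fintype ι] (v : ι → Cc G) (f : Cc G) :
    IsSelfAdjoint (sqDiff v f) := by
  simp [IsSelfAdjoint, sqDiff, star_sum]

lemma inner_sqDiff {ι : Type*} [Fintype ι] (v : ι → Cc G) (f : Cc G) (x : UnitSpace G)
    (ξ : Ell2 (SrcFiber x)) :
    inner ℂ (regRep x (sqDiff v f) ξ) ξ =
      ((∑ k, ‖regOp (v k) x ξ‖ ^ 2 - ‖regOp f x ξ‖ ^ 2 : ℝ) : ℂ) := by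
  have h : ∀ T : Ell2 (SrcFiber x) →L[ℂ] Ell2 (SrcFiber x),
      inner ℂ ((star T * T) ξ) ξ = ((‖T ξ‖ ^ 2 : ℝ) : ℂ) := fun T => by
    rw [ContinuousLinearMap.star_eq_adjoint, mul_apply_eq_comp,
      ContinuousLinearMap.adjoint_inner_left, inner_self_eq_norm_sq_to_K]
    simp
  simp only [sqDiff, map_sub, map_sum, map_mul, map_star, regRep_reducedOf,
    sub_apply, sum_apply, inner_sub_left, sum_inner, h]
  push_cast
  rfl

lemma regRep_sqDiff_nonneg_iff {ι : Type*} [Fintype ι] (v : ι → Cc G) (f : Cc G)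
    (x : UnitSpace G) :
    0 ≤ regRep x (sqDiff v f) ↔
      ∀ ξ : Ell2 (SrcFiber x), ‖regOp f x ξ‖ ^ 2 ≤ ∑ k, ‖regOp (v k) x ξ‖ ^ 2 := by
  rw [ContinuousLinearMap.nonneg_iff_isPositive, ContinuousLinearMap.isPositive_iff_complex]
  simp only [inner_sqDiff]
  refine forall_congr' fun ξ => ?_
  rw [RCLike.re_to_complex, Complex.ofReal_re]
  simp only [true_and, sub_nonneg]

end

lemma directSumRep_eq_zero {A : Type*} [NonUnitalCStarAlgebra A] {ι : Type*} {H : ι → Type*}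
    [∀ i, NormedAddCommGroup (H i)] [∀ i, InnerProductSpace ℂ (H i)] [∀ i, CompleteSpace (H i)]
    {σ : ∀ i, A →⋆ₙₐ[ℂ] (H i →L[ℂ] H i)} {a : A} (h : ∀ i, σ i a = 0) :
    directSumRep σ a = 0 := by
  ext ξ i
  simp [directSumRep, h]

/-! ### Comparison over `Y` and the conclusion -/

/-- If `f` is a contractive function supported on units in `O`, and each `g ∈ G_y` with range in
`O` is fixed by some `v_k`, then `ρ_y(f⋆ f) ≤ ∑ ρ_y(v_k⋆ v_k)`. -/
lemma norm_regOp_sq_le {G : Type*} [TopologicalSpace G] [EtaleGroupoid G] {ι : Type*} [Fintype ι]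
    {v : ι → Cc G} {f : Cc G} {y : UnitSpace G} {O : Set G}
    (hfO : ∀ h ∉ O, (f : G → ℂ) h = 0) (hO : ∀ h ∈ O, src h = h)
    (hf1 : ∀ h, ‖(f : G → ℂ) h‖ ≤ 1)
    (hv : ∀ g : SrcFiber y, rng (g : G) ∈ O → ∃ k, (v k : G → ℂ) (rng (g : G)) = 1 ∧
      ∀ h, rng h = rng (g : G) → h ≠ rng (g : G) → (v k : G → ℂ) h = 0)
    (ξ : Ell2 (SrcFiber y)) :
    ‖regOp f y ξ‖ ^ 2 ≤ ∑ k, ‖regOp (v k) y ξ‖ ^ 2 := by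
  -- The comparison is coordinatewise: `f` multiplies `ξ g` by `f (rng g)`, of modulus at most `1`,
  -- and a single `v k` fixing `ξ g` already dominates.
  refine hasSum_le (fun g => ?_) (hasSum_norm_sq _)
    (hasSum_sum fun k (_ : k ∈ Finset.univ) => hasSum_norm_sq (regOp (v k) y ξ))
  have hfg : regOp f y ξ g = (f : G → ℂ) (rng (g : G)) * ξ g := by
    refine regFun_eq_of_support _ g fun h hr hne => hfO h fun hm => hne ?_
    have := rng_src h
    rw [hO h hm] at this
    rw [← hr, this]
  rw [hfg]
  by_cases hg : rng (g : G) ∈ O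
  · obtain ⟨k, hk1, hk0⟩ := hv g hg
    have hvg : regOp (v k) y ξ g = ξ g := by
      refine (regFun_eq_of_support _ g hk0).trans ?_
      rw [hk1, one_mul]
    refine le_trans ?_ (Finset.single_le_sum
      (f := fun k => ‖regOp (v k) y ξ g‖ ^ 2) (fun _ _ => sq_nonneg _) (Finset.mem_univ k))
    dsimp only
    rw [hvg, norm_mul]
    gcongr
    exact mul_le_of_le_one_left (norm_nonneg _) (hf1 _)
  · rw [hfO _ hg, zero_mul, norm_zero, zero_pow two_ne_zero]
    exact Finset.sum_nonneg fun _ _ => sq_nonneg _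

/-- In the hypothesis on the orders, `1 / orderOf (g k)` is `0` when `g k` has infinite order, as
`orderOf (g k) = 0` in this case. -/
theorem proposition1p7 {G : Type*} [TopologicalSpace G] [EtaleGroupoid G]
    (Y : Set (UnitSpace G)) (hY : IsInvariant Y) (x : UnitSpace G) (hx : x ∉ Y)
    (n : ℕ) (hn : 1 ≤ n) (g : Fin n → Isotropy x) (hg : ∀ k, g k ≠ 1)
    (U : Fin n → Set G) (hU : ∀ k, IsOpenBisection (U k)) (hgU : ∀ k, (g k).1 ∈ U k)
    (W : Set (UnitSpace G)) (hW : W ∈ 𝓝 x)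
    (hYW : ∀ y ∈ Y ∩ W, ∃ k, (y : G) ∈ U k)
    (hord : ∑ k, 1 / (orderOf (g k) : ℝ) < 1) :
    ¬ WeaklyContained (regRep x) (directSumRep fun y : Y => regRep (y : UnitSpace G)) := by
  classical
  intro hwc
  obtain ⟨N, hN, hinj, hsum⟩ := exists_pow_injOn g hord
  choose v hvx hv using fun k => exists_average (g k) (hN k) (hinj k) (hU k) (hgU k)
  obtain ⟨O₁, hO₁, hxO₁, hunits⟩ := exists_isOpen_subset_units x
  have hW' : {z : UnitSpace G | z ∈ W ∧ ∀ k, (z : G) ∈ U k →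
      (v k : G → ℂ) z = 1 ∧ ∀ h : G, rng h = z → h ≠ z → (v k : G → ℂ) h = 0} ∈ 𝓝 x :=
    Filter.inter_mem hW (Filter.eventually_all.2 hv)
  obtain ⟨W', hW'sub, hW'o, hxW'⟩ := mem_nhds_iff.1 hW'
  have hsrcx : srcMap (x : G) = x := Subtype.ext x.2
  obtain ⟨f, B, -, -, hBO, hf0, hf1, hfx⟩ := exists_bump (x : G)
    (hO₁.inter (hW'o.preimage (EtaleGroupoid.isLocalHomeomorph_src (G := G)).continuous))
    ⟨hxO₁, by rwa [mem_preimage, hsrcx]⟩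
  have hpos : ∀ y ∈ Y, 0 ≤ regRep y (sqDiff v f) := by
    intro y hy
    refine (regRep_sqDiff_nonneg_iff v f y).2
      (norm_regOp_sq_le hf0 (fun h hh => hunits h (hBO hh).1) hf1 fun c hc => ?_)
    have hsr : srcMap (rng (c : G)) = rngMap (c : G) := Subtype.ext (src_rng _)
    have hcW' : rngMap (c : G) ∈ W' := hsr ▸ (hBO hc).2
    -- Invariance puts the range of `c ∈ G_y` in `Y`, where the covering by the `U k` applies.
    have hcY : rngMap (c : G) ∈ Y :=
      (hY c).1 (by rwa [show srcMap (c : G) = y from Subtype.ext c.2])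
    obtain ⟨k, hk⟩ := hYW _ ⟨hcY, (hW'sub hcW').1⟩
    exact ⟨k, (hW'sub hcW').2 k hk⟩
  have hsa := isSelfAdjoint_sqDiff v f
  -- Weak containment is applied to the negative part of `sqDiff v f`.
  have hnonneg : 0 ≤ regRep x (sqDiff v f) :=
    (regRep x).map_nonneg_of_map_negPart_eq_zero hsa <| hwc _ <| directSumRep_eq_zero fun y =>
      (regRep (y : UnitSpace G)).map_negPart_eq_zero hsa (hpos y y.2)
  have hle := (regRep_sqDiff_nonneg_iff v f x).1 hnonneg (lp.single 2 ⟨x, x.2⟩ 1)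
  have hfn : 1 ≤ ‖regOp f x (lp.single 2 ⟨x, x.2⟩ 1)‖ := by
    have h := lp.norm_apply_le_norm (p := 2) (by norm_num) (regOp f x (lp.single 2 ⟨x, x.2⟩ 1))
      ⟨x, x.2⟩
    rwa [regOp_single, hfx.self_of_nhds, norm_one] at h
  simp only [hvx] at hle
  -- At `δ_x` the inequality reads `1 ≤ ‖ρ_x(f) δ_x‖ ^ 2 ≤ ∑ 1 / N k < 1`.
  nlinarith
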